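/- Let $X$ be a compact connected (Hausdorff) complex manifold of dimension $k$. A holomorphic correspondence on $X$ is a nonempty finite formal sum $\Gamma=\sum_{j} m_j\Gamma_j$, with positive integers $m_j$ and distinct irreducible complex subvarieties $\Gamma_j\subset X\times X$ of dimension $k$, such that both projections map each $\Gamma_j$ onto $X$, and such that every point of $X$ has, counted with multiplicity, only finitely many images and finitely many preimages. For $z\in X$ let $F^{\dagger}(z)$ be the multiset of preimages of $z$, i.e. of the $w$ with $(w,z)\in\bigcup_j\Gamma_j$, where $w$ is repeated $\sum_j m_j\,\nu_j(w,z)$ times, $\nu_j(w,z)$ being the local multiplicity at $(w,z)$ of the second projection restricted to $\Gamma_j$ (and $0$ if $(w,z)\notin\Gamma_j$). Let $(F^{0})^{\dagger}(z)=\{z\}$ and $(F^{n})^{\dagger}(z)=F^{\dagger}\big((F^{n-1})^{\dagger}(z)\big)$, with multiplicities. The topological degree $d$ of $F$ is the number of points of $F^{\dagger}(z)$, counted with multiplicity, for generic $z$ (all $z$ outside a proper complex subvariety of $X$). For a Borel probability measure $\mu$ on $X$ the measure $(F^n)^{*}\mu$ is defined by $\langle (F^n)^{*}\mu,\varphi\rangle=\int_X\sum_{w\in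 (F^n)^{\dagger}(z)}\varphi(w)\,d\mu(z)$ for continuous $\varphi:X\to\mathbb R$ (sum with multiplicities), and $\mu$ is called $F^{*}$-invariant if $F^{*}\mu=d\mu$. Proposition. Let $F_1,F_2$ be holomorphic correspondences on compact connected complex manifolds $X_1,X_2$, given by $\Gamma^1=\sum_i m_i\Gamma^1_i$ and $\Gamma^2=\sum_j n_j\Gamma^2_j$, and let $d_1,d_2$ be their topological degrees. Let $F_1\times F_2$ be given by $\Gamma^1\times\Gamma^2=\sum_{i,j} m_in_j\,S^{-1}(\Gamma^1_i\times\Gamma^2_j)$, where $S(z_1,z_2,z_3,z_4)=(z_1,z_3,z_2,z_4)$. Then $F_1\times F_2$ is a holomorphic correspondence on $X_1\times X_2$, of topological degree $d_1d_2$. If $\mu_1$ and $\mu_2$ are Borel probability measures on $X_1$ and $X_2$ that are $F_1^{*}$-invariant and $F_2^{*}$-invariant respectively, then $$\big((F_1\times F_2)^{n}\big)^{*}(\mu_1\times\mu_2)=d_1^{\,n}d_2^{\,n}\,(\mu_1\times\mu_2)\qquad\text{for all } n\in\mathbb N .$$ In particular $\mu_1\times\mu_2$ is $(F_1\times F_2)^{*}$-invariant.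 -/

import Mathlib

open MeasureTheory Filter Topology
open scoped Manifold ContDiff ENNReal

noncomputable section

namespace HolCorr

/-! ### Complex subvarieties of a complex manifold -/

section Varieties

variable {E : Type*} [NormedAddCommGroup E] [NormedSpace ℂ E]
  {H : Type*} [TopologicalSpace H] (I : ModelWithCorners ℂ E H)
  {M : Type*} [TopologicalSpace M] [ChartedSpace H M]

/-- `A` is a complex (analytic) subvariety of `M`: near every point of `M` (not only of `A`, so
that `A` is closed), it is the common zero set of finitely many holomorphic functions. -/
def IsSubvariety (A : Set M) : Prop :=
  ∀ x : M, ∃ U : Set M, IsOpen U ∧ x ∈ U ∧ ∃ (r : ℕ) (f : Fin r → M → ℂ),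
    (∀ i, MDifferentiableOn I 𝓘(ℂ, ℂ) (f i) U) ∧ A ∩ U = {y ∈ U | ∀ i, f i y = 0}

/-- `x` is a regular point of `A` at which `A` has dimension `m`: near `x`, the set `A` is a complex
submanifold of dimension `m`, cut out by `c = dim M - m` holomorphic equations whose differentials
at `x` are linearly independent. -/
def IsRegularPoint (A : Set M) (m : ℕ) (x : M) : Prop :=
  x ∈ A ∧ ∃ c : ℕ, m + c = Module.finrank ℂ E ∧ ∃ U : Set M, IsOpen U ∧ x ∈ U ∧
    ∃ f : M → (Fin c → ℂ), MDifferentiableOn I 𝓘(ℂ, Fin c → ℂ) f U ∧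
      Function.Surjective (mfderiv I 𝓘(ℂ, Fin c → ℂ) f x) ∧ A ∩ U = {y ∈ U | f y = 0}

/-- The regular part of `A`: the points near which `A` is a complex submanifold of `M`. -/
def regularPart (A : Set M) : Set M := {x | ∃ m, IsRegularPoint I A m x}

/-- `A` is an irreducible complex subvariety of `M` of dimension `m`: it is a subvariety, its
regular part is connected and non-empty, and the points at which it is a submanifold of
dimension `m` are dense in it. -/
structure IsIrreducibleSubvariety (A : Set M) (m : ℕ) : Prop where
  isSubvariety : IsSubvariety I A
  isConnected_regularPart : IsConnected (regularPart I A)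
  pure_dim : A ⊆ closure {x | IsRegularPoint I A m x}

end Varieties

/-- The local multiplicity (local number of sheets) at the point `p` of the restriction of `π` to
`A`: for all small neighbourhoods `U` of `p`, this is the number of points of `A ∩ U` over a generic
`z` close to `π p`, that is, the largest number of points of `A ∩ U` over points `z`
arbitrarily close to `π p`. -/
def localMultiplicity {Y X : Type*} [TopologicalSpace Y] [TopologicalSpace X]
    (π : Y → X) (A : Set Y) (p : Y) : ℕ∞ :=
  ⨅ U ∈ 𝓝 p, limsup (fun z : X => (A ∩ U ∩ π ⁻¹' {z}).encard) (𝓝 (π p))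

/-! ### Holomorphic correspondences

A formal sum `∑ m_j Γ_j` of distinct subsets `Γ_j` of `X × X` with positive integer
coefficients is a finitely supported function `Γ : Set (X × X) →₀ ℕ`; the `Γ_j` are the elements of
its support, and `m_j = Γ Γ_j`. -/

section Correspondences

variable {E : Type*} [NormedAddCommGroup E] [NormedSpace ℂ E]
  {H : Type*} [TopologicalSpace H] (I : ModelWithCorners ℂ E H)
  {X : Type*} [TopologicalSpace X] [ChartedSpace H X]

/-- The formal sum `Γ` is a holomorphic correspondence on `X`. The last two conditions say that the
sets of images and of preimages of a point, where the points are repeated according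
to their multiplicities, are finite. -/
structure IsHolomorphicCorrespondence (Γ : Set (X × X) →₀ ℕ) : Prop where
  ne_zero : Γ ≠ 0
  irreducible : ∀ A ∈ Γ.support,
    IsIrreducibleSubvariety (I.prod I) A (Module.finrank ℂ E)
  surjective_fst : ∀ A ∈ Γ.support, Prod.fst '' A = Set.univ
  surjective_snd : ∀ A ∈ Γ.support, Prod.snd '' A = Set.univ
  finite_images : ∀ A ∈ Γ.support, ∀ z : X, (A ∩ Prod.fst ⁻¹' {z}).Finite ∧
    ∀ p ∈ A ∩ Prod.fst ⁻¹' {z}, localMultiplicity Prod.fst A p ≠ ⊤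
  finite_preimages : ∀ A ∈ Γ.support, ∀ z : X, (A ∩ Prod.snd ⁻¹' {z}).Finite ∧
    ∀ p ∈ A ∩ Prod.snd ⁻¹' {z}, localMultiplicity Prod.snd A p ≠ ⊤

end Correspondences

/-- The multiplicity of `w` as a preimage of `z` under `Γ = ∑ m_j Γ_j`: the sum over `j` of `m_j`
times the local multiplicity at `(w, z)` of the second projection restricted to `Γ_j`. -/
def preimageMultiplicity {X : Type*} [TopologicalSpace X] (Γ : Set (X × X) →₀ ℕ) (w z : X) : ℕ :=
  Γ.sum fun A m => m * (localMultiplicity Prod.snd A (w, z)).toNat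

/-- `F†(z)`, the preimages of `z` repeated according to multiplicity. -/
def preimages {X : Type*} [TopologicalSpace X] (Γ : Set (X × X) →₀ ℕ) (z : X) : Multiset X :=
  ∑ᶠ w : X, preimageMultiplicity Γ w z • ({w} : Multiset X)

/-- `(F^n)†(z)`, with multiplicities: `(F^(n+1))†(z) = F†((F^n)†(z))`. -/
def iterPreimages {X : Type*} [TopologicalSpace X] (Γ : Set (X × X) →₀ ℕ) :
    ℕ → X → Multiset X
  | 0, z => {z}
  | n + 1, z => (iterPreimages Γ n z).bind (preimages Γ)

/-- `d` is the topological degree of `Γ`: the number of preimages, counted with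
multiplicity, of a generic point, that is, of every point outside some proper subvariety. -/
def HasTopologicalDegree {E : Type*} [NormedAddCommGroup E] [NormedSpace ℂ E]
    {H : Type*} [TopologicalSpace H] (I : ModelWithCorners ℂ E H)
    {X : Type*} [TopologicalSpace X] [ChartedSpace H X] (Γ : Set (X × X) →₀ ℕ) (d : ℕ) : Prop :=
  ∃ Z : Set X, IsSubvariety I Z ∧ Z ≠ Set.univ ∧ ∀ z ∉ Z, (preimages Γ z).card = d

/-! ### Pull-back of measures -/

/-- `ν` is the pull-back of `μ` under the multivalued map with preimages `P z`: the
functional `φ ↦ ∫ ∑_{w ∈ P z} φ w dμ(z)` on continuous functions is defined and equals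
`φ ↦ ∫ φ dν`. -/
def IsPullback {X : Type*} [TopologicalSpace X] [MeasurableSpace X] (P : X → Multiset X)
    (μ ν : Measure X) : Prop :=
  ∀ φ : C(X, ℝ), Integrable (fun z => ((P z).map φ).sum) μ ∧
    ∫ z, ((P z).map φ).sum ∂μ = ∫ z, φ z ∂ν

/-- `μ` is `F^*`-invariant, `F` being the correspondence `Γ`, of topological degree `d`:
`F^* μ = d μ`. -/
def IsStarInvariant {X : Type*} [TopologicalSpace X] [MeasurableSpace X]
    (Γ : Set (X × X) →₀ ℕ) (d : ℕ) (μ : Measure X) : Prop :=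
  IsPullback (preimages Γ) μ ((d : ℝ≥0∞) • μ)

/-! ### Products -/

/-- `S⁻¹(A × B)`, where `S (z₁, z₂, z₃, z₄) = (z₁, z₃, z₂, z₄)`. -/
def prodSet {X₁ X₂ : Type*} (A : Set (X₁ × X₁)) (B : Set (X₂ × X₂)) :
    Set ((X₁ × X₂) × (X₁ × X₂)) :=
  {p | (p.1.1, p.2.1) ∈ A ∧ (p.1.2, p.2.2) ∈ B}

/-- The product `Γ¹ × Γ² = ∑_i ∑_j m_i n_j S⁻¹(Γ_i¹ × Γ_j²)` of formal sums. -/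
def prodCorr {X₁ X₂ : Type*} (Γ₁ : Set (X₁ × X₁) →₀ ℕ) (Γ₂ : Set (X₂ × X₂) →₀ ℕ) :
    Set ((X₁ × X₂) × (X₁ × X₂)) →₀ ℕ :=
  Γ₁.sum fun A m => Γ₂.sum fun B n => Finsupp.single (prodSet A B) (m * n)

end HolCorr

end

namespace HolCorr

/-! ### Local multiplicities -/

section LocalMultiplicity

/-! Everything rests on the multiset identity (F₁ × F₂)†(z₁, z₂) = F₁†(z₁) × F₂†(z₂),
`preimages_prodCorr`. It follows from multiplicativity of local multiplicities
(`localMultiplicity_prod`): fibres of A × B in a box are products of fibres, and finite limsups of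
ℕ∞-valued functions multiply over a product filter.

On the geometric side, products of regular points are regular and dense in the product, which gives
irreducibility.

On the measure side, invariance is known only on continuous functions. It extends to Borel functions
through closed sets (`IsPullback.pullsBack`), passes to the product through rectangles and Tonelli
(`pullsBack_product`), and iterates by induction (`pullsBack_iterPreimages`). Working with
measurable functions is essential, since z ↦ ∑ φ(w) over F†(z) need not be continuous, so continuous
test functions are not known to be stable under iteration. -/

lemma frequently_limsup_le {α : Type*} {l : Filter α} [l.NeBot] {f : α → ℕ∞}
    (h : limsup f l ≠ ⊤) : ∃ᶠ x in l, limsup f l ≤ f x := by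
  lift limsup f l to ℕ using h with a ha
  cases a with
  | zero => simpa using ‹l.NeBot›
  | succ b =>
    -- Values in ℕ∞ are discrete: exceeding b, which happens frequently, already means reaching b +
    -- 1.
    have hb : ((b : ℕ) : ℕ∞) < limsup f l := by
      rw [← ha]; exact_mod_cast Nat.lt_succ_self b
    refine (frequently_lt_of_lt_limsup (by isBoundedDefault) hb).mono fun x hx => ?_
    push_cast
    exact Order.add_one_le_of_lt hx

lemma eventually_le_limsup_enat {α : Type*} {l : Filter α} {f : α → ℕ∞}
    (h : limsup f l ≠ ⊤) : ∀ᶠ x in l, f x ≤ limsup f l := by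
  have : limsup f l < limsup f l + 1 := ENat.lt_add_one_iff h |>.2 le_rfl
  exact (eventually_lt_of_limsup_lt this).mono fun x hx => (ENat.lt_add_one_iff h).1 hx

/-- A finite limsup in ℕ∞ is eventually an upper bound and is frequently reached. Both properties
pass to pairs, because frequent events in the two factors occur jointly and frequently for the
product filter. -/
lemma limsup_mul_prod {α β : Type*} {l : Filter α} {l' : Filter β} [l.NeBot] [l'.NeBot]
    {f : α → ℕ∞} {g : β → ℕ∞} (hf : limsup f l ≠ ⊤) (hg : limsup g l' ≠ ⊤) :
    limsup (fun p : α × β => f p.1 * g p.2) (l ×ˢ l') = limsup f l * limsup g l' := by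
  apply le_antisymm
  · refine limsup_le_of_le (by isBoundedDefault) ?_
    filter_upwards [(eventually_le_limsup_enat hf).prod_mk (eventually_le_limsup_enat hg)]
      with p hp using mul_le_mul' hp.1 hp.2
  · refine le_limsup_of_frequently_le ?_ (by isBoundedDefault)
    exact (frequently_prod_and.2 ⟨frequently_limsup_le hf, frequently_limsup_le hg⟩).mono
      fun p hp => mul_le_mul' hp.1 hp.2

lemma limsup_encard_mono {Y X : Type*} (π : Y → X) (A : Set Y) (l : Filter X) {U V : Set Y} (h : U ⊆ V) :
    limsup (fun z : X => (A ∩ U ∩ π ⁻¹' {z}).encard) l ≤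
      limsup (fun z : X => (A ∩ V ∩ π ⁻¹' {z}).encard) l :=
  limsup_le_limsup (Eventually.of_forall fun z => Set.encard_le_encard (by gcongr))

variable {Y X Y' X' : Type*} [TopologicalSpace Y] [TopologicalSpace X]
  [TopologicalSpace Y'] [TopologicalSpace X']

lemma localMultiplicity_le (π : Y → X) (A : Set Y) {p : Y} {U : Set Y} (hU : U ∈ 𝓝 p) :
    localMultiplicity π A p ≤ limsup (fun z : X => (A ∩ U ∩ π ⁻¹' {z}).encard) (𝓝 (π p)) :=
  iInf₂_le U hU

/-- The infimum defining the local multiplicity is attained on all small neighbourhoods. -/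
lemma exists_nhds_limsup_eq (π : Y → X) (A : Set Y) (p : Y) :
    ∃ U ∈ 𝓝 p, ∀ V ∈ 𝓝 p, V ⊆ U →
      limsup (fun z : X => (A ∩ V ∩ π ⁻¹' {z}).encard) (𝓝 (π p)) = localMultiplicity π A p := by
  have : Nonempty {U // U ∈ 𝓝 p} := ⟨⟨Set.univ, univ_mem⟩⟩
  -- ℕ∞ is well ordered, so the infimum over neighbourhoods is a minimum.
  obtain ⟨⟨U, hU⟩, h⟩ := ciInf_mem fun U : {U // U ∈ 𝓝 p} =>
    limsup (fun z : X => (A ∩ U.1 ∩ π ⁻¹' {z}).encard) (𝓝 (π p))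
  rw [iInf_subtype] at h
  refine ⟨U, hU, fun V hV hVU => le_antisymm ?_ (localMultiplicity_le π A hV)⟩
  exact (limsup_encard_mono π A _ hVU).trans h.le

lemma localMultiplicity_eq_zero {π : Y → X} {A : Set Y} (hA : IsClosed A) {p : Y} (hp : p ∉ A) :
    localMultiplicity π A p = 0 := by
  refine le_antisymm ((localMultiplicity_le π A (hA.isOpen_compl.mem_nhds hp)).trans ?_)
    zero_le
  simp

lemma localMultiplicity_prod {π : Y → X} {π' : Y' → X'} {A : Set Y} {B : Set Y'} {p : Y × Y'}
    (hA : localMultiplicity π A p.1 ≠ ⊤) (hB : localMultiplicity π' B p.2 ≠ ⊤) :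
    localMultiplicity (Prod.map π π') (A ×ˢ B) p =
      localMultiplicity π A p.1 * localMultiplicity π' B p.2 := by
  obtain ⟨U, hU, hU'⟩ := exists_nhds_limsup_eq π A p.1
  obtain ⟨V, hV, hV'⟩ := exists_nhds_limsup_eq π' B p.2
  -- On small boxes both infima are already attained, and the fibre of the product is the product of
  -- the fibres. Boxes are cofinal among neighbourhoods, so this settles both inequalities.
  have key : ∀ U₁ ∈ 𝓝 p.1, U₁ ⊆ U → ∀ V₁ ∈ 𝓝 p.2, V₁ ⊆ V →
      limsup (fun z : X × X' => (A ×ˢ B ∩ U₁ ×ˢ V₁ ∩ Prod.map π π' ⁻¹' {z}).encard)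
        (𝓝 (Prod.map π π' p)) = localMultiplicity π A p.1 * localMultiplicity π' B p.2 := by
    intro U₁ h₁ h₁' V₁ h₂ h₂'
    rw [← hU' U₁ h₁ h₁'] at hA ⊢
    rw [← hV' V₁ h₂ h₂'] at hB ⊢
    rw [← limsup_mul_prod hA hB, Prod.map_apply', nhds_prod_eq]
    congr 1
    funext z
    rw [← Set.encard_prod]
    congr 1
    ext ⟨a, b⟩
    simp only [Set.mem_inter_iff, Set.mem_prod, Set.mem_preimage, Prod.map_apply,
      Set.mem_singleton_iff, Prod.ext_iff]
    tauto
  apply le_antisymm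
  · rw [← key U hU le_rfl V hV le_rfl]
    exact localMultiplicity_le _ _ (prod_mem_nhds hU hV)
  · refine le_iInf₂ fun W hW => ?_
    obtain ⟨U₁, h₁, V₁, h₂, h⟩ := mem_nhds_prod_iff.1 hW
    rw [← key (U₁ ∩ U) (inter_mem h₁ hU) Set.inter_subset_right (V₁ ∩ V) (inter_mem h₂ hV)
      Set.inter_subset_right]
    exact limsup_encard_mono _ _ _
      ((Set.prod_mono Set.inter_subset_left Set.inter_subset_left).trans h)

lemma localMultiplicity_comp_homeomorph (e : Y' ≃ₜ Y) (π : Y → X) (A : Set Y) (p : Y') :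
    localMultiplicity (π ∘ e) (e ⁻¹' A) p = localMultiplicity π A (e p) := by
  have h : ∀ (U : Set Y) (z : X), (e ⁻¹' A ∩ e ⁻¹' U ∩ (π ∘ e) ⁻¹' {z}).encard =
      (A ∩ U ∩ π ⁻¹' {z}).encard := fun U z => by
    rw [Set.preimage_comp, ← Set.preimage_inter, ← Set.preimage_inter,
      Set.encard_preimage_of_bijective e.bijective]
  apply le_antisymm
  · refine le_iInf₂ fun U hU => ?_
    refine (localMultiplicity_le _ _ (e.continuous.continuousAt hU)).trans ?_
    simp only [h]
    exact le_rfl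
  · refine le_iInf₂ fun U hU => ?_
    have hU' : e.symm ⁻¹' U ∈ 𝓝 (e p) :=
      e.symm.continuous.continuousAt (by simpa using hU)
    refine (localMultiplicity_le _ _ hU').trans ?_
    simp only [← h, ← Set.preimage_comp, e.symm_comp_self]
    exact le_rfl

end LocalMultiplicity

/-! ### Local multiplicities of the rearranged product `prodSet` -/

section ProdSet

variable {X₁ X₂ : Type*} [TopologicalSpace X₁] [TopologicalSpace X₂]

lemma prodSet_eq (A : Set (X₁ × X₁)) (B : Set (X₂ × X₂)) :
    prodSet A B = Homeomorph.prodProdProdComm X₁ X₂ X₁ X₂ ⁻¹' (A ×ˢ B) := rfl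

lemma localMultiplicity_fst_prodSet {A : Set (X₁ × X₁)} {B : Set (X₂ × X₂)}
    {p : (X₁ × X₂) × (X₁ × X₂)} (hA : localMultiplicity Prod.fst A (p.1.1, p.2.1) ≠ ⊤)
    (hB : localMultiplicity Prod.fst B (p.1.2, p.2.2) ≠ ⊤) :
    localMultiplicity Prod.fst (prodSet A B) p = localMultiplicity Prod.fst A (p.1.1, p.2.1) *
      localMultiplicity Prod.fst B (p.1.2, p.2.2) :=
  (localMultiplicity_comp_homeomorph (Homeomorph.prodProdProdComm X₁ X₂ X₁ X₂)
    (Prod.map Prod.fst Prod.fst) (A ×ˢ B) p).trans (localMultiplicity_prod hA hB)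

lemma localMultiplicity_snd_prodSet {A : Set (X₁ × X₁)} {B : Set (X₂ × X₂)}
    {p : (X₁ × X₂) × (X₁ × X₂)} (hA : localMultiplicity Prod.snd A (p.1.1, p.2.1) ≠ ⊤)
    (hB : localMultiplicity Prod.snd B (p.1.2, p.2.2) ≠ ⊤) :
    localMultiplicity Prod.snd (prodSet A B) p = localMultiplicity Prod.snd A (p.1.1, p.2.1) *
      localMultiplicity Prod.snd B (p.1.2, p.2.2) :=
  (localMultiplicity_comp_homeomorph (Homeomorph.prodProdProdComm X₁ X₂ X₁ X₂)
    (Prod.map Prod.snd Prod.snd) (A ×ˢ B) p).trans (localMultiplicity_prod hA hB)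

end ProdSet

/-! ### Pull-back of measures on non-negative functions -/

section Measures

/-- `∑_{w ∈ s} f w`. -/
noncomputable def multisetSum {X : Type*} (s : Multiset X) (f : X → ℝ≥0∞) : ℝ≥0∞ := (s.map f).sum

section Sum

variable {X Y : Type*}

/-- As integrals against a sum of Dirac masses, multiset sums inherit monotone convergence. -/
lemma multisetSum_eq_lintegral [MeasurableSpace X] (s : Multiset X) {f : X → ℝ≥0∞}
    (hf : Measurable f) : multisetSum s f = ∫⁻ x, f x ∂(s.map Measure.dirac).sum := by
  induction s using Multiset.induction_on with
  | empty => simp [multisetSum]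
  | cons a s ih =>
    simp only [multisetSum, Multiset.map_cons, Multiset.sum_cons, lintegral_add_measure] at ih ⊢
    rw [ih, lintegral_dirac' _ hf]

lemma multisetSum_lt_top (s : Multiset X) {f : X → ℝ≥0∞} (hf : ∀ x, f x ≠ ⊤) :
    multisetSum s f ≠ ⊤ := by
  induction s using Multiset.induction_on with
  | empty => simp [multisetSum]
  | cons a s ih => simpa [multisetSum, hf] using ih

lemma multisetSum_mono (s : Multiset X) {f g : X → ℝ≥0∞} (h : ∀ x, f x ≤ g x) :
    multisetSum s f ≤ multisetSum s g :=
  Multiset.sum_map_le_sum_map _ _ fun x _ => h x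

lemma multisetSum_bind (s : Multiset X) (P : X → Multiset Y) (f : Y → ℝ≥0∞) :
    multisetSum (s.bind P) f = multisetSum s fun x => multisetSum (P x) f := by
  simp [multisetSum, Multiset.map_bind, Multiset.sum_bind]

lemma multisetSum_product (s : Multiset X) (t : Multiset Y) (f : X → ℝ≥0∞) (g : Y → ℝ≥0∞) :
    multisetSum (s ×ˢ t) (fun p => f p.1 * g p.2) = multisetSum s f * multisetSum t g := by
  induction s using Multiset.induction_on with
  | empty => simp [multisetSum]
  | cons a s ih =>
    simp only [multisetSum, Multiset.cons_product, Multiset.map_add, Multiset.map_map,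
      Multiset.sum_add, Multiset.map_cons, Multiset.sum_cons, add_mul] at ih ⊢
    rw [ih]
    congr 1
    simp [Multiset.sum_map_mul_left]

lemma toReal_multisetSum_ofReal (s : Multiset X) {f : X → ℝ} (hf : ∀ x, 0 ≤ f x) :
    (multisetSum s fun x => ENNReal.ofReal (f x)).toReal = (s.map f).sum := by
  induction s using Multiset.induction_on with
  | empty => simp [multisetSum]
  | cons a s ih =>
    have h := multisetSum_lt_top s (f := fun x => ENNReal.ofReal (f x)) fun _ => ENNReal.ofReal_ne_top
    simp only [multisetSum, Multiset.map_cons, Multiset.sum_cons] at ih h ⊢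
    rw [ENNReal.toReal_add ENNReal.ofReal_ne_top h, ih, ENNReal.toReal_ofReal (hf a)]

lemma multisetSum_ofReal (s : Multiset X) {f : X → ℝ} (hf : ∀ x, 0 ≤ f x) :
    multisetSum s (fun x => ENNReal.ofReal (f x)) = ENNReal.ofReal (s.map f).sum := by
  rw [← toReal_multisetSum_ofReal s hf, ENNReal.ofReal_toReal]
  exact multisetSum_lt_top _ fun _ => ENNReal.ofReal_ne_top

end Sum

variable {X : Type*} [MeasurableSpace X]

/-- `ν` is the pull-back of `μ` under the multivalued map with preimages `P z`, tested on the
single function `f`. -/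
def PullsBack (P : X → Multiset X) (μ ν : Measure X) (f : X → ℝ≥0∞) : Prop :=
  AEMeasurable (fun z => multisetSum (P z) f) μ ∧
    ∫⁻ z, multisetSum (P z) f ∂μ = ∫⁻ z, f z ∂ν

lemma PullsBack.add {P : X → Multiset X} {μ ν : Measure X} {f g : X → ℝ≥0∞}
    (hf : PullsBack P μ ν f) (hg : PullsBack P μ ν g) (hfm : Measurable f) :
    PullsBack P μ ν (f + g) := by
  have h : ∀ z, multisetSum (P z) (f + g) = multisetSum (P z) f + multisetSum (P z) g :=
    fun z => by simp [multisetSum, Multiset.sum_map_add]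
  simp only [PullsBack, h]
  refine ⟨hf.1.add hg.1, ?_⟩
  rw [lintegral_add_left' hf.1, hf.2, hg.2]
  exact (lintegral_add_left hfm g).symm

lemma PullsBack.const_mul {P : X → Multiset X} {μ ν : Measure X} {f : X → ℝ≥0∞}
    (hf : PullsBack P μ ν f) (hfm : Measurable f) (c : ℝ≥0∞) :
    PullsBack P μ ν (fun x => c * f x) := by
  have h : ∀ z, multisetSum (P z) (fun x => c * f x) = c * multisetSum (P z) f :=
    fun z => by simp [multisetSum, Multiset.sum_map_mul_left]
  simp only [PullsBack, h]
  refine ⟨hf.1.const_mul c, ?_⟩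
  rw [lintegral_const_mul'' _ hf.1, hf.2, lintegral_const_mul _ hfm]

lemma PullsBack.iSup {P : X → Multiset X} {μ ν : Measure X} {f : ℕ → X → ℝ≥0∞}
    (hf : ∀ n, PullsBack P μ ν (f n)) (hfm : ∀ n, Measurable (f n)) (hmono : Monotone f) :
    PullsBack P μ ν (fun x => ⨆ n, f n x) := by
  have h : ∀ z, multisetSum (P z) (fun x => ⨆ n, f n x) = ⨆ n, multisetSum (P z) (f n) :=
    fun z => by
      simp only [multisetSum_eq_lintegral _ (hfm _), multisetSum_eq_lintegral _ (Measurable.iSup hfm)]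
      exact lintegral_iSup hfm hmono
  simp only [PullsBack, h]
  refine ⟨AEMeasurable.iSup fun n => (hf n).1, ?_⟩
  rw [lintegral_iSup' (fun n => (hf n).1), lintegral_iSup hfm hmono]
  · simp only [(hf _).2]
  · exact Eventually.of_forall fun z m n hmn => multisetSum_mono _ (hmono hmn)

/-- A pull-back relation that holds on a generating π-system holds on all measurable functions. -/
lemma pullsBack_of_piSystem {P : X → Multiset X} {μ ν : Measure X} [IsFiniteMeasure ν]
    {C : Set (Set X)} (hgen : ‹MeasurableSpace X› = MeasurableSpace.generateFrom C)
    (hC : IsPiSystem C) (huniv : Set.univ ∈ C)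
    (h : ∀ s ∈ C, PullsBack P μ ν (s.indicator 1)) {f : X → ℝ≥0∞} (hf : Measurable f) :
    PullsBack P μ ν f := by
  have hzero : PullsBack P μ ν (fun _ => 0) := by simp [PullsBack, multisetSum]
  have hset : ∀ s, MeasurableSet s → PullsBack P μ ν (s.indicator 1) := by
    refine MeasurableSpace.induction_on_inter hgen hC (by simpa using hzero) h ?_ ?_
    · intro t ht hpt
      have hu := h _ huniv
      -- The sums are finite, so truncated subtraction in `ℝ≥0∞` is exact here.
      have hsub : ∀ z, multisetSum (P z) (tᶜ.indicator 1) =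
          multisetSum (P z) (Set.univ.indicator 1) - multisetSum (P z) (t.indicator 1) := by
        intro z
        refine ENNReal.eq_sub_of_add_eq (multisetSum_lt_top _ fun x => ?_) ?_
        · by_cases hx : x ∈ t <;> simp [hx]
        · rw [multisetSum, multisetSum, ← Multiset.sum_map_add, multisetSum]
          congr 2
          funext x
          by_cases hx : x ∈ t <;> simp [hx]
      have hle : ∀ z, multisetSum (P z) (t.indicator 1) ≤
          multisetSum (P z) (Set.univ.indicator 1) := fun z =>
        multisetSum_mono _ fun x => Set.indicator_le_indicator_of_subset (Set.subset_univ _)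
          (fun _ => zero_le) x
      simp only [PullsBack, hsub]
      refine ⟨hu.1.sub hpt.1, ?_⟩
      rw [lintegral_sub' hpt.1 _ (Eventually.of_forall hle), hu.2, hpt.2]
      · simp only [Set.indicator_univ, Pi.one_apply, lintegral_one, lintegral_indicator_one ht,
          lintegral_indicator_one ht.compl]
        exact (measure_compl ht (measure_ne_top _ _)).symm
      · rw [hpt.2, lintegral_indicator_one ht]
        exact measure_ne_top _ _
    · intro s hd hs hps
      -- A disjoint union is the increasing limit of its finite partial unions, reached by
      -- additivity and monotone convergence.
      have hpart : ∀ n : ℕ, PullsBack P μ ν ((⋃ i ∈ Finset.range n, s i).indicator 1) := by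
        intro n
        induction n with
        | zero => simpa using hzero
        | succ n ih =>
          have := (ih.add (hps n) (measurable_one.indicator
            (Finset.measurableSet_biUnion _ fun i _ => hs i)))
          convert this using 1
          rw [Finset.range_add_one, Finset.set_biUnion_insert, Set.union_comm]
          refine Set.indicator_union_of_disjoint ?_ _
          simp only [Set.disjoint_iUnion_left, Finset.mem_range]
          exact fun i hi => hd hi.ne
      have hmono : Monotone fun n : ℕ => (⋃ i ∈ Finset.range n, s i) := fun m n hmn =>
        Set.biUnion_subset_biUnion_left fun i hi =>
          Finset.range_mono hmn hi
      have hsup := PullsBack.iSup hpart (fun n => measurable_one.indicator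
        (Finset.measurableSet_biUnion _ fun i _ => hs i))
        (fun m n hmn x => Set.indicator_le_indicator_of_subset (hmono hmn) (fun _ => zero_le) x)
      convert hsup using 1
      funext x
      have hU : (⋃ i, s i) = ⋃ n : ℕ, ⋃ i ∈ Finset.range n, s i := by
        ext y
        simp only [Set.mem_iUnion, Finset.mem_range]
        exact ⟨fun ⟨i, hi⟩ => ⟨i + 1, i, by omega, hi⟩, fun ⟨_, i, _, hi⟩ => ⟨i, hi⟩⟩
      rw [hU]
      by_cases hx : x ∈ ⋃ n : ℕ, ⋃ i ∈ Finset.range n, s i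
      · rw [Set.indicator_of_mem hx]
        obtain ⟨n, hn⟩ := Set.mem_iUnion.1 hx
        refine le_antisymm ?_ (iSup_le fun n => Set.indicator_le_self _ _ _)
        exact (Set.indicator_of_mem hn (1 : X → ℝ≥0∞)).symm.le.trans (le_iSup
          (fun n : ℕ => (⋃ i ∈ Finset.range n, s i).indicator (1 : X → ℝ≥0∞) x) n)
      · rw [Set.indicator_of_notMem hx]
        simp only [Set.mem_iUnion, not_exists] at hx
        symm
        simpa using hx
  refine Measurable.ennreal_induction (motive := PullsBack P μ ν) ?_ ?_ ?_ hf
  · intro c s hs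
    convert (hset s hs).const_mul (measurable_one.indicator hs) c using 1
    funext x
    by_cases hx : x ∈ s <;> simp [hx]
  · exact fun f g _ hfm _ hf hg => hf.add hg hfm
  · exact fun f hfm hmono hf => PullsBack.iSup hf hfm hmono

/-- Indicators of closed sets are limits of continuous functions with values in [0, 1], so dominated
convergence reaches the π-system of closed sets, which generates the Borel sets. -/
lemma IsPullback.pullsBack [TopologicalSpace X] [CompactSpace X] [BorelSpace X]
    [HasOuterApproxClosed X] {P : X → Multiset X} {μ ν : Measure X}
    [IsFiniteMeasure ν] (h : IsPullback P μ ν) {f : X → ℝ≥0∞} (hf : Measurable f) :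
    PullsBack P μ ν f := by
  have hcont : ∀ φ : BoundedContinuousFunction X NNReal,
      PullsBack P μ ν (fun x => φ x) := by
    intro φ
    let ψ : C(X, ℝ) := ⟨fun x => φ x, by fun_prop⟩
    have hψ : ∀ x, 0 ≤ ψ x := fun x => (φ x).2
    have hofReal : ∀ x, (φ x : ℝ≥0∞) = ENNReal.ofReal (ψ x) := fun x => by simp [ψ]
    obtain ⟨h₁, h₂⟩ := h ψ
    simp only [PullsBack, hofReal, multisetSum_ofReal _ hψ]
    refine ⟨h₁.1.aemeasurable.ennreal_ofReal, ?_⟩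
    rw [← ofReal_integral_eq_lintegral_ofReal h₁ (Eventually.of_forall fun z =>
      Multiset.sum_nonneg (by simpa using fun x _ => hψ x)), h₂,
      ofReal_integral_eq_lintegral_ofReal _ (Eventually.of_forall hψ)]
    exact φ.integrable_of_nnreal ν
  refine pullsBack_of_piSystem (BorelSpace.measurable_eq.trans borel_eq_generateFrom_isClosed)
    isPiSystem_isClosed isClosed_univ (fun s hs => ?_) hf
  have hs : IsClosed s := hs
  have hlim : ∀ x, Tendsto (fun n => (hs.apprSeq n x : ℝ≥0∞)) atTop
      (𝓝 (s.indicator 1 x)) := by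
    intro x
    have := tendsto_pi_nhds.1 (HasOuterApproxClosed.tendsto_apprSeq hs) x
    convert ENNReal.tendsto_coe.2 this using 2
    by_cases hx : x ∈ s <;> simp [hx]
  have hle : ∀ n x, (hs.apprSeq n x : ℝ≥0∞) ≤ 1 := fun n x =>
    mod_cast HasOuterApproxClosed.apprSeq_apply_le_one hs n x
  have hsum : ∀ z, Tendsto (fun n => multisetSum (P z) fun x => (hs.apprSeq n x : ℝ≥0∞)) atTop
      (𝓝 (multisetSum (P z) (s.indicator 1))) := by
    intro z
    exact tendsto_multiset_sum (P z) fun x _ => hlim x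
  -- Testing on the constant 1 shows that z ↦ card (P z) has finite integral; it serves as the
  -- dominating function.
  have hone := hcont 1
  simp only [BoundedContinuousFunction.coe_one, Pi.one_apply, ENNReal.coe_one] at hone
  refine ⟨aemeasurable_of_tendsto_metrizable_ae' (fun n => (hcont (hs.apprSeq n)).1)
    (Eventually.of_forall hsum), ?_⟩
  refine tendsto_nhds_unique (tendsto_lintegral_of_dominated_convergence' (fun z =>
    multisetSum (P z) fun _ => 1) (fun n => (hcont (hs.apprSeq n)).1)
    (fun n => Eventually.of_forall fun z => multisetSum_mono _ (hle n)) ?_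
    (Eventually.of_forall hsum)) ?_
  · rw [hone.2, lintegral_one]
    exact measure_ne_top _ _
  · simp only [(hcont _).2]
    refine tendsto_lintegral_of_dominated_convergence' (fun _ => 1) (fun n => by fun_prop)
      (fun n => Eventually.of_forall (hle n)) ?_ (Eventually.of_forall hlim)
    rw [lintegral_one]
    exact measure_ne_top _ _

lemma isPullback_of_pullsBack [TopologicalSpace X] [CompactSpace X] [OpensMeasurableSpace X]
    {P : X → Multiset X} {μ ν : Measure X} [IsFiniteMeasure ν]
    (h : ∀ f : X → ℝ≥0∞, Measurable f → PullsBack P μ ν f) : IsPullback P μ ν := by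
  have hpos : ∀ ψ : C(X, ℝ), (∀ x, 0 ≤ ψ x) → Integrable (fun z => ((P z).map ψ).sum) μ ∧
      ∫ z, ((P z).map ψ).sum ∂μ = ∫ z, ψ z ∂ν := by
    intro ψ hψ
    have hm : Measurable ψ := ψ.continuous.measurable
    obtain ⟨h₁, h₂⟩ := h _ hm.ennreal_ofReal
    have hint : Integrable ψ ν :=
      (BoundedContinuousFunction.mkOfCompact ψ).integrable ν
    have hfin : ∫⁻ z, multisetSum (P z) (fun x => ENNReal.ofReal (ψ x)) ∂μ ≠ ⊤ := by
      rw [h₂, ← ofReal_integral_eq_lintegral_ofReal hint (Eventually.of_forall hψ)]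
      exact ENNReal.ofReal_ne_top
    simp only [← toReal_multisetSum_ofReal _ hψ]
    refine ⟨integrable_toReal_of_lintegral_ne_top h₁ hfin, ?_⟩
    rw [integral_toReal h₁ (ae_lt_top' h₁ hfin), h₂,
      integral_eq_lintegral_of_nonneg_ae (Eventually.of_forall hψ) hm.aestronglyMeasurable]
  intro φ
  -- Positive and negative parts are continuous, which reduces the claim to non-negative functions.
  let φp : C(X, ℝ) := φ ⊔ 0
  let φn : C(X, ℝ) := (-φ) ⊔ 0
  obtain ⟨h₁, h₂⟩ := hpos φp fun x => le_sup_right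
  obtain ⟨h₃, h₄⟩ := hpos φn fun x => le_sup_right
  have hφ : ∀ x, φ x = φp x - φn x := fun x => by
    simp [φp, φn]
  have hsum : ∀ z, ((P z).map φ).sum = ((P z).map φp).sum - ((P z).map φn).sum := fun z => by
    rw [← Multiset.sum_map_sub]
    simp only [hφ]
  simp only [hsum]
  refine ⟨h₁.sub h₃, ?_⟩
  simp only [hφ]
  rw [integral_sub h₁ h₃, h₂, h₄, integral_sub]
  · exact (BoundedContinuousFunction.mkOfCompact φp).integrable ν
  · exact (BoundedContinuousFunction.mkOfCompact φn).integrable ν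

/-- If N is ν-null, pulling back its indicator shows that μ-almost every z has no point of P z in N.
Changing f on N thus changes the sums only on a μ-null set. Iteration needs this, as a pulled-back
function is only known to be a.e. measurable. -/
lemma pullsBack_of_aemeasurable {P : X → Multiset X} {μ ν : Measure X}
    (h : ∀ f : X → ℝ≥0∞, Measurable f → PullsBack P μ ν f) {f : X → ℝ≥0∞}
    (hf : AEMeasurable f ν) : PullsBack P μ ν f := by
  obtain ⟨g, hg, hfg⟩ := hf
  obtain ⟨N, hN, hNm, hN₀⟩ := exists_measurable_superset_of_null hfg
  have hind := h (N.indicator 1) (measurable_one.indicator hNm)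
  have hae : ∀ᵐ z ∂μ, multisetSum (P z) f = multisetSum (P z) g := by
    have h₀ := hind.2
    rw [lintegral_indicator_one hNm, hN₀, lintegral_eq_zero_iff' hind.1] at h₀
    filter_upwards [h₀] with z hz
    simp only [multisetSum]
    congr 1
    refine Multiset.map_congr rfl fun x hx => ?_
    by_contra hne
    have hxN : x ∈ N := hN hne
    have : (1 : ℝ≥0∞) ≤ multisetSum (P z) (N.indicator 1) := by
      refine le_trans ?_ (Multiset.single_le_sum (fun _ _ => zero_le) _
        (Multiset.mem_map_of_mem _ hx))
      simp [hxN]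
    rw [hz] at this
    simp at this
  refine ⟨(h g hg).1.congr (hae.mono fun z hz => hz.symm), ?_⟩
  rw [lintegral_congr_ae hae, (h g hg).2, lintegral_congr_ae hfg]

lemma pullsBack_iterPreimages {X : Type*} [TopologicalSpace X] [MeasurableSpace X]
    {Γ : Set (X × X) →₀ ℕ} {μ : Measure X} {c : ℝ≥0∞}
    (h : ∀ f : X → ℝ≥0∞, Measurable f → PullsBack (preimages Γ) μ (c • μ) f) (n : ℕ)
    {f : X → ℝ≥0∞} (hf : AEMeasurable f μ) :
    PullsBack (iterPreimages Γ n) μ (c ^ n • μ) f := by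
  induction n generalizing f with
  | zero => simpa [PullsBack, iterPreimages, multisetSum] using hf
  | succ n ih =>
    -- The induction hypothesis is applied to z ↦ ∑ f(w) over F†(z); integrating that function then
    -- yields the last factor c.
    have h₁ := pullsBack_of_aemeasurable h (hf.smul_measure c)
    have h₂ := ih h₁.1
    simp only [PullsBack, iterPreimages, multisetSum_bind]
    refine ⟨h₂.1, ?_⟩
    rw [h₂.2, lintegral_smul_measure, h₁.2, lintegral_smul_measure, lintegral_smul_measure,
      smul_smul, pow_succ]

/-- On indicators of measurable rectangles both sides factor by Tonelli, and rectangles form a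
generating π-system. -/
lemma pullsBack_product {Y : Type*} [MeasurableSpace Y] {P : X → Multiset X}
    {Q : Y → Multiset Y} {μ ν : Measure X} {μ' ν' : Measure Y} [SFinite μ] [SFinite μ']
    [IsFiniteMeasure ν] [IsFiniteMeasure ν']
    (h : ∀ f : X → ℝ≥0∞, Measurable f → PullsBack P μ ν f)
    (h' : ∀ f : Y → ℝ≥0∞, Measurable f → PullsBack Q μ' ν' f)
    {f : X × Y → ℝ≥0∞} (hf : Measurable f) :
    PullsBack (fun z => P z.1 ×ˢ Q z.2) (μ.prod μ') (ν.prod ν') f := by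
  refine pullsBack_of_piSystem generateFrom_prod.symm isPiSystem_prod
    ⟨Set.univ, .univ, Set.univ, .univ, Set.univ_prod_univ⟩ ?_ hf
  rintro _ ⟨s, hs, t, ht, rfl⟩
  have hs' := h _ (measurable_one.indicator hs)
  have ht' := h' _ (measurable_one.indicator ht)
  have hst : ((s ×ˢ t).indicator 1 : X × Y → ℝ≥0∞) =
      fun p => s.indicator 1 p.1 * t.indicator 1 p.2 := by
    funext p
    by_cases h₁ : p.1 ∈ s <;> by_cases h₂ : p.2 ∈ t <;> simp [Set.indicator, h₁, h₂]
  rw [hst]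
  simp only [PullsBack, multisetSum_product]
  refine ⟨hs'.1.comp_fst.mul ht'.1.comp_snd, ?_⟩
  rw [lintegral_prod_mul hs'.1 ht'.1, hs'.2, ht'.2, lintegral_prod_mul
    (measurable_one.indicator hs).aemeasurable (measurable_one.indicator ht).aemeasurable]

end Measures

/-! ### Subvarieties under preimages, unions and products -/

section Varieties

variable {E : Type*} [NormedAddCommGroup E] [NormedSpace ℂ E]
  {H : Type*} [TopologicalSpace H] {I : ModelWithCorners ℂ E H}
  {M : Type*} [TopologicalSpace M] [ChartedSpace H M]

lemma IsSubvariety.isClosed {A : Set M} (hA : IsSubvariety I A) : IsClosed A := by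
  rw [← isOpen_compl_iff, isOpen_iff_mem_nhds]
  intro x hx
  obtain ⟨U, hU, hxU, r, f, hf, hAU⟩ := hA x
  have hx' : ∃ i, f i x ≠ 0 := by
    by_contra! h
    have : x ∈ A ∩ U := by rw [hAU]; exact ⟨hxU, h⟩
    exact hx this.1
  obtain ⟨i, hi⟩ := hx'
  have hc : ContinuousAt (f i) x := (hf i).continuousOn.continuousAt (hU.mem_nhds hxU)
  filter_upwards [hc.eventually_ne hi, hU.mem_nhds hxU] with y hy hyU hyA
  have : y ∈ A ∩ U := ⟨hyA, hyU⟩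
  rw [hAU] at this
  exact hy (this.2 i)

lemma IsSubvariety.inter {A B : Set M} (hA : IsSubvariety I A) (hB : IsSubvariety I B) :
    IsSubvariety I (A ∩ B) := by
  intro x
  obtain ⟨U, hU, hxU, r, f, hf, hAU⟩ := hA x
  obtain ⟨V, hV, hxV, s, g, hg, hBV⟩ := hB x
  refine ⟨U ∩ V, hU.inter hV, ⟨hxU, hxV⟩, r + s, Fin.append f g, fun i => ?_, ?_⟩
  · refine i.addCases (fun i => ?_) fun i => ?_
    · simpa using (hf i).mono Set.inter_subset_left
    · simpa using (hg i).mono Set.inter_subset_right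
  · rw [Set.inter_inter_inter_comm, hAU, hBV]
    ext y
    simp only [Set.mem_inter_iff, Set.mem_ofPred_eq, Fin.forall_fin_add, Fin.append_left,
      Fin.append_right]
    tauto

lemma IsSubvariety.union {A B : Set M} (hA : IsSubvariety I A) (hB : IsSubvariety I B) :
    IsSubvariety I (A ∪ B) := by
  intro x
  obtain ⟨U, hU, hxU, r, f, hf, hAU⟩ := hA x
  obtain ⟨V, hV, hxV, s, g, hg, hBV⟩ := hB x
  -- The union is cut out by all pairwise products of the two families of equations.
  refine ⟨U ∩ V, hU.inter hV, ⟨hxU, hxV⟩, r * s,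
    fun k => f (finProdFinEquiv.symm k).1 * g (finProdFinEquiv.symm k).2, fun k => ?_, ?_⟩
  · intro y hy
    exact ((hf _).mono Set.inter_subset_left y hy).mul ((hg _).mono Set.inter_subset_right y hy)
  · ext y
    have h₁ : y ∈ U → (y ∈ A ↔ ∀ i, f i y = 0) := fun hy => by
      simpa [hy] using Set.ext_iff.1 hAU y
    have h₂ : y ∈ V → (y ∈ B ↔ ∀ i, g i y = 0) := fun hy => by
      simpa [hy] using Set.ext_iff.1 hBV y
    simp only [Set.mem_inter_iff, Set.mem_union, Set.mem_ofPred_eq, Pi.mul_apply, mul_eq_zero]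
    refine ⟨fun ⟨h, hU, hV⟩ => ⟨⟨hU, hV⟩, fun k => ?_⟩, fun ⟨⟨hU, hV⟩, h⟩ => ⟨?_, hU, hV⟩⟩
    · rw [h₁ hU, h₂ hV] at h
      exact h.imp (fun h => h _) fun h => h _
    · rw [h₁ hU, h₂ hV]
      by_contra! hne
      obtain ⟨⟨i, hi⟩, ⟨j, hj⟩⟩ := hne
      have := h (finProdFinEquiv (i, j))
      simp [hi, hj] at this

variable {E' : Type*} [NormedAddCommGroup E'] [NormedSpace ℂ E']
  {H' : Type*} [TopologicalSpace H'] {I' : ModelWithCorners ℂ E' H'}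
  {N : Type*} [TopologicalSpace N] [ChartedSpace H' N]

lemma IsSubvariety.preimage {A : Set M} (hA : IsSubvariety I A) {q : N → M}
    (hq : MDifferentiable I' I q) : IsSubvariety I' (q ⁻¹' A) := by
  intro x
  obtain ⟨U, hU, hxU, r, f, hf, hAU⟩ := hA (q x)
  refine ⟨q ⁻¹' U, hU.preimage hq.continuous, hxU, r, fun i => f i ∘ q,
    fun i => (hf i).comp hq.mdifferentiableOn subset_rfl, ?_⟩
  rw [← Set.preimage_inter, hAU]
  rfl

variable {E₂ : Type*} [NormedAddCommGroup E₂] [NormedSpace ℂ E₂]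
  {H₂ : Type*} [TopologicalSpace H₂] {I₂ : ModelWithCorners ℂ E₂ H₂}
  {M₂ : Type*} [TopologicalSpace M₂] [ChartedSpace H₂ M₂]

/-- If `(q, q₂)` is a local splitting of `N` into a product, the preimages of two submanifolds
intersect in a submanifold whose dimension is the sum of the two dimensions. -/
lemma IsRegularPoint.preimage_inter {A : Set M} {B : Set M₂} {m n : ℕ} {q : N → M} {q₂ : N → M₂}
    {x : N} (hq : MDifferentiable I' I q) (hq₂ : MDifferentiable I' I₂ q₂)
    (hdim : Module.finrank ℂ E' = Module.finrank ℂ E + Module.finrank ℂ E₂)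
    (hsurj : ∀ (u : TangentSpace I (q x)) (v : TangentSpace I₂ (q₂ x)),
      ∃ t : TangentSpace I' x, mfderiv I' I q x t = u ∧ mfderiv I' I₂ q₂ x t = v)
    (hA : IsRegularPoint I A m (q x)) (hB : IsRegularPoint I₂ B n (q₂ x)) :
    IsRegularPoint I' (q ⁻¹' A ∩ q₂ ⁻¹' B) (m + n) x := by
  obtain ⟨hxA, c, hc, U, hU, hxU, f, hf, hfs, hAU⟩ := hA
  obtain ⟨hxB, d, hd, V, hV, hxV, g, hg, hgs, hBV⟩ := hB
  -- The two systems of equations are stacked into one with c + d components; `L₁` and `L₂` insert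
  -- each system into its block.
  let e : ((Fin c → ℂ) × (Fin d → ℂ)) ≃L[ℂ] (Fin (c + d) → ℂ) :=
    ContinuousLinearEquiv.ofFinrankEq (by simp)
  let L₁ : (Fin c → ℂ) →L[ℂ] (Fin (c + d) → ℂ) :=
    e.toContinuousLinearMap.comp (ContinuousLinearMap.inl ℂ _ _)
  let L₂ : (Fin d → ℂ) →L[ℂ] (Fin (c + d) → ℂ) :=
    e.toContinuousLinearMap.comp (ContinuousLinearMap.inr ℂ _ _)
  have hL : ∀ a b, L₁ a + L₂ b = e (a, b) := fun a b => by
    simp [L₁, L₂, ← map_add]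
  have hfx := ((hf _ hxU).mdifferentiableAt (hU.mem_nhds hxU)).hasMFDerivAt
  have hgx := ((hg _ hxV).mdifferentiableAt (hV.mem_nhds hxV)).hasMFDerivAt
  have h₁ := (L₁.hasMFDerivAt (x := f (q x))).comp x (hfx.comp x (hq x).hasMFDerivAt)
  have h₂ := (L₂.hasMFDerivAt (x := g (q₂ x))).comp x (hgx.comp x (hq₂ x).hasMFDerivAt)
  refine ⟨⟨hxA, hxB⟩, c + d, by omega, q ⁻¹' U ∩ q₂ ⁻¹' V,
    (hU.preimage hq.continuous).inter (hV.preimage hq₂.continuous), ⟨hxU, hxV⟩,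
    L₁ ∘ f ∘ q + L₂ ∘ g ∘ q₂, ?_, ?_, ?_⟩
  · intro y hy
    refine MDifferentiableAt.mdifferentiableWithinAt ?_
    have hfy := (hf _ hy.1).mdifferentiableAt (hU.mem_nhds hy.1)
    have hgy := (hg _ hy.2).mdifferentiableAt (hV.mem_nhds hy.2)
    exact ((L₁.mdifferentiableAt).comp y (hfy.comp y (hq y))).add
      ((L₂.mdifferentiableAt).comp y (hgy.comp y (hq₂ y)))
  · rw [(h₁.add h₂).mfderiv]
    intro w
    obtain ⟨⟨a, b⟩, rfl⟩ := e.surjective w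
    obtain ⟨u, hu⟩ := hfs a
    obtain ⟨v, hv⟩ := hgs b
    -- The splitting realises both tangent vectors by a single t, so the stacked differential is
    -- onto.
    obtain ⟨t, ht, ht'⟩ := hsurj u v
    refine ⟨t, ?_⟩
    rw [← hL]
    change L₁ (mfderiv I 𝓘(ℂ, Fin c → ℂ) f (q x) (mfderiv I' I q x t)) +
      L₂ (mfderiv I₂ 𝓘(ℂ, Fin d → ℂ) g (q₂ x) (mfderiv I' I₂ q₂ x t)) = _
    rw [ht, ht', hu, hv]
  · ext y
    have h₁ : q y ∈ U → (q y ∈ A ↔ f (q y) = 0) := fun hy => by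
      simpa [hy] using Set.ext_iff.1 hAU (q y)
    have h₂ : q₂ y ∈ V → (q₂ y ∈ B ↔ g (q₂ y) = 0) := fun hy => by
      simpa [hy] using Set.ext_iff.1 hBV (q₂ y)
    simp only [Set.mem_inter_iff, Set.mem_preimage, Set.mem_ofPred_eq, Pi.add_apply,
      Function.comp_apply, hL, map_eq_zero_iff e e.injective, Prod.mk_eq_zero]
    constructor
    · rintro ⟨⟨hA, hB⟩, hU, hV⟩
      exact ⟨⟨hU, hV⟩, (h₁ hU).1 hA, (h₂ hV).1 hB⟩
    · rintro ⟨⟨hU, hV⟩, hA, hB⟩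
      exact ⟨⟨(h₁ hU).2 hA, (h₂ hV).2 hB⟩, hU, hV⟩

end Varieties

/-! ### Irreducibility and regular points of `prodSet` -/

section ProdSet

variable {E₁ : Type*} [NormedAddCommGroup E₁] [NormedSpace ℂ E₁]
  {H₁ : Type*} [TopologicalSpace H₁] {I₁ : ModelWithCorners ℂ E₁ H₁}
  {X₁ : Type*} [TopologicalSpace X₁] [ChartedSpace H₁ X₁]
  {E₂ : Type*} [NormedAddCommGroup E₂] [NormedSpace ℂ E₂]
  {H₂ : Type*} [TopologicalSpace H₂] {I₂ : ModelWithCorners ℂ E₂ H₂}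
  {X₂ : Type*} [TopologicalSpace X₂] [ChartedSpace H₂ X₂]

lemma hasMFDerivAt_prodMk_fst_fst (p : (X₁ × X₂) × (X₁ × X₂)) :
    HasMFDerivAt ((I₁.prod I₂).prod (I₁.prod I₂)) (I₁.prod I₁)
      (fun p : (X₁ × X₂) × (X₁ × X₂) => (p.1.1, p.2.1)) p
      (((ContinuousLinearMap.fst ℂ E₁ E₂).comp (ContinuousLinearMap.fst ℂ (E₁ × E₂) (E₁ × E₂))).prod
        ((ContinuousLinearMap.fst ℂ E₁ E₂).comp
          (ContinuousLinearMap.snd ℂ (E₁ × E₂) (E₁ × E₂)))) :=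
  ((hasMFDerivAt_fst p.1).comp p (hasMFDerivAt_fst p)).prodMk
    ((hasMFDerivAt_fst p.2).comp p (hasMFDerivAt_snd p))

lemma hasMFDerivAt_prodMk_snd_snd (p : (X₁ × X₂) × (X₁ × X₂)) :
    HasMFDerivAt ((I₁.prod I₂).prod (I₁.prod I₂)) (I₂.prod I₂)
      (fun p : (X₁ × X₂) × (X₁ × X₂) => (p.1.2, p.2.2)) p
      (((ContinuousLinearMap.snd ℂ E₁ E₂).comp (ContinuousLinearMap.fst ℂ (E₁ × E₂) (E₁ × E₂))).prod
        ((ContinuousLinearMap.snd ℂ E₁ E₂).comp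
          (ContinuousLinearMap.snd ℂ (E₁ × E₂) (E₁ × E₂)))) :=
  ((hasMFDerivAt_snd p.1).comp p (hasMFDerivAt_fst p)).prodMk
    ((hasMFDerivAt_snd p.2).comp p (hasMFDerivAt_snd p))

lemma IsRegularPoint.prodSet [FiniteDimensional ℂ E₁] [FiniteDimensional ℂ E₂]
    {A : Set (X₁ × X₁)} {B : Set (X₂ × X₂)} {m n : ℕ} {p : (X₁ × X₂) × (X₁ × X₂)}
    (hA : IsRegularPoint (I₁.prod I₁) A m (p.1.1, p.2.1))
    (hB : IsRegularPoint (I₂.prod I₂) B n (p.1.2, p.2.2)) :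
    IsRegularPoint ((I₁.prod I₂).prod (I₁.prod I₂)) (prodSet A B) (m + n) p := by
  refine IsRegularPoint.preimage_inter
    (fun p => (hasMFDerivAt_prodMk_fst_fst p).mdifferentiableAt)
    (fun p => (hasMFDerivAt_prodMk_snd_snd p).mdifferentiableAt) ?_ ?_ hA hB
  · simp only [Module.finrank_prod]
    ring
  · intro u v
    rw [(hasMFDerivAt_prodMk_fst_fst p).mfderiv, (hasMFDerivAt_prodMk_snd_snd p).mfderiv]
    exact ⟨((u.1, v.1), (u.2, v.2)), rfl, rfl⟩

lemma IsSubvariety.prodSet {A : Set (X₁ × X₁)} {B : Set (X₂ × X₂)}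
    (hA : IsSubvariety (I₁.prod I₁) A) (hB : IsSubvariety (I₂.prod I₂) B) :
    IsSubvariety ((I₁.prod I₂).prod (I₁.prod I₂)) (prodSet A B) :=
  (hA.preimage fun p => (hasMFDerivAt_prodMk_fst_fst p).mdifferentiableAt).inter
    (hB.preimage fun p => (hasMFDerivAt_prodMk_snd_snd p).mdifferentiableAt)

lemma prodSet_subset_closure {A A' : Set (X₁ × X₁)} {B B' : Set (X₂ × X₂)}
    (hA : A ⊆ closure A') (hB : B ⊆ closure B') : prodSet A B ⊆ closure (prodSet A' B') := by
  rw [prodSet_eq, prodSet_eq, ← Homeomorph.preimage_closure, closure_prod_eq]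
  exact Set.preimage_mono (Set.prod_mono hA hB)

/-- The product of the regular parts is connected, lies in the regular part of the product, and is
dense in the product. A set between a connected set and its closure is connected, so the regular
part need not be identified exactly. -/
lemma IsIrreducibleSubvariety.prodSet [FiniteDimensional ℂ E₁] [FiniteDimensional ℂ E₂]
    {A : Set (X₁ × X₁)} {B : Set (X₂ × X₂)} {m n : ℕ}
    (hA : IsIrreducibleSubvariety (I₁.prod I₁) A m)
    (hB : IsIrreducibleSubvariety (I₂.prod I₂) B n) :
    IsIrreducibleSubvariety ((I₁.prod I₂).prod (I₁.prod I₂)) (prodSet A B) (m + n) where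
  isSubvariety := hA.isSubvariety.prodSet hB.isSubvariety
  isConnected_regularPart := by
    have hconn : IsConnected (HolCorr.prodSet (regularPart (I₁.prod I₁) A)
        (regularPart (I₂.prod I₂) B)) := by
      rw [prodSet_eq, Homeomorph.isConnected_preimage]
      exact hA.isConnected_regularPart.prod hB.isConnected_regularPart
    refine hconn.subset_closure ?_ ?_
    · rintro p ⟨⟨k, hk⟩, ⟨l, hl⟩⟩
      exact ⟨k + l, hk.prodSet hl⟩
    · rintro p ⟨_, hp⟩
      have hA' := closure_mono (t := regularPart (I₁.prod I₁) A) fun _ h => ⟨m, h⟩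
      have hB' := closure_mono (t := regularPart (I₂.prod I₂) B) fun _ h => ⟨n, h⟩
      exact prodSet_subset_closure (hA.pure_dim.trans hA') (hB.pure_dim.trans hB') hp.1
  pure_dim := (prodSet_subset_closure hA.pure_dim hB.pure_dim).trans
    (closure_mono fun _ hp => hp.1.prodSet hp.2)

end ProdSet

/-! ### Multisets of preimages -/

section Preimages

lemma count_product {α β : Type*} [DecidableEq α] [DecidableEq β] (s : Multiset α)
    (t : Multiset β) (a : α) (b : β) : (s ×ˢ t).count (a, b) = s.count a * t.count b := by
  induction s using Multiset.induction_on with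
  | empty => simp
  | cons x s ih =>
    rw [Multiset.cons_product, Multiset.count_add, ih, Multiset.count_cons, add_mul, add_comm]
    congr 1
    by_cases h : a = x
    · subst h
      simpa using Multiset.count_map_eq_count' (Prod.mk a) t (Prod.mk_right_injective a) b
    · simp [h, eq_comm]

/-- A `finsum` with infinite support is 0 by convention; finiteness makes `preimages` the intended
sum. -/
lemma count_preimages {X : Type*} [TopologicalSpace X] [DecidableEq X] {Γ : Set (X × X) →₀ ℕ}
    {z : X} (h : (Function.support fun w => preimageMultiplicity Γ w z).Finite) (w : X) :
    (preimages Γ z).count w = preimageMultiplicity Γ w z := by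
  rw [preimages, finsum_eq_sum_of_support_subset (s := h.toFinset), Multiset.count_sum']
  · simp only [Multiset.count_nsmul, Multiset.count_singleton, mul_ite, mul_one, mul_zero,
      Finset.sum_ite_eq, Set.Finite.mem_toFinset, Function.mem_support]
    split_ifs with h' <;> simp_all
  · intro w hw
    simp only [Set.Finite.coe_toFinset, Function.mem_support] at hw ⊢
    exact fun h₀ => hw (by simp [h₀])

variable {E : Type*} [NormedAddCommGroup E] [NormedSpace ℂ E]
  {H : Type*} [TopologicalSpace H] {I : ModelWithCorners ℂ E H}
  {X : Type*} [TopologicalSpace X] [ChartedSpace H X] {Γ : Set (X × X) →₀ ℕ}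

lemma IsHolomorphicCorrespondence.localMultiplicity_fst_ne_top
    (h : IsHolomorphicCorrespondence I Γ) {A : Set (X × X)} (hA : A ∈ Γ.support) (p : X × X) :
    localMultiplicity Prod.fst A p ≠ ⊤ := by
  by_cases hp : p ∈ A
  · exact (h.finite_images A hA p.1).2 p ⟨hp, rfl⟩
  · simp [localMultiplicity_eq_zero (h.irreducible A hA).isSubvariety.isClosed hp]

lemma IsHolomorphicCorrespondence.localMultiplicity_snd_ne_top
    (h : IsHolomorphicCorrespondence I Γ) {A : Set (X × X)} (hA : A ∈ Γ.support) (p : X × X) :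
    localMultiplicity Prod.snd A p ≠ ⊤ := by
  by_cases hp : p ∈ A
  · exact (h.finite_preimages A hA p.2).2 p ⟨hp, rfl⟩
  · simp [localMultiplicity_eq_zero (h.irreducible A hA).isSubvariety.isClosed hp]

lemma IsHolomorphicCorrespondence.finite_support_preimageMultiplicity
    (h : IsHolomorphicCorrespondence I Γ) (z : X) :
    (Function.support fun w => preimageMultiplicity Γ w z).Finite := by
  refine (Γ.support.finite_toSet.biUnion fun A hA =>
    (h.finite_preimages A hA z).1.image Prod.fst).subset fun w hw => ?_
  obtain ⟨A, hA, hne⟩ := Finset.exists_ne_zero_of_sum_ne_zero hw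
  refine Set.mem_biUnion hA ⟨(w, z), ⟨?_, rfl⟩, rfl⟩
  by_contra hp
  exact hne (by simp [localMultiplicity_eq_zero (h.irreducible A hA).isSubvariety.isClosed hp])

end Preimages

/-! ### Products of correspondences -/

section Product

/-- Only this inclusion of supports is used: pairs with the same product would merely add their
coefficients. -/
lemma exists_of_mem_support_prodCorr {X₁ X₂ : Type*} {Γ₁ : Set (X₁ × X₁) →₀ ℕ}
    {Γ₂ : Set (X₂ × X₂) →₀ ℕ} {C : Set ((X₁ × X₂) × (X₁ × X₂))}
    (hC : C ∈ (prodCorr Γ₁ Γ₂).support) :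
    ∃ A ∈ Γ₁.support, ∃ B ∈ Γ₂.support, C = prodSet A B := by
  classical
  rw [Finsupp.mem_support_iff, prodCorr, Finsupp.sum, Finsupp.finsetSum_apply] at hC
  obtain ⟨A, hA, hC⟩ := Finset.exists_ne_zero_of_sum_ne_zero hC
  rw [Finsupp.sum, Finsupp.finsetSum_apply] at hC
  obtain ⟨B, hB, hC⟩ := Finset.exists_ne_zero_of_sum_ne_zero hC
  refine ⟨A, hA, B, hB, ?_⟩
  by_contra hne
  exact hC (Finsupp.single_eq_of_ne hne)

lemma prodCorr_ne_zero {X₁ X₂ : Type*} {Γ₁ : Set (X₁ × X₁) →₀ ℕ}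
    {Γ₂ : Set (X₂ × X₂) →₀ ℕ} (h₁ : Γ₁ ≠ 0) (h₂ : Γ₂ ≠ 0) : prodCorr Γ₁ Γ₂ ≠ 0 := by
  obtain ⟨A, hA⟩ := Finsupp.support_nonempty_iff.2 h₁
  obtain ⟨B, hB⟩ := Finsupp.support_nonempty_iff.2 h₂
  intro h
  -- Coefficients are natural numbers, so no cancellation can occur.
  have h' := (Finset.sum_eq_zero_iff.1 h) A hA
  have h'' := (Finset.sum_eq_zero_iff.1 h') B hB
  rw [Finsupp.mem_support_iff] at hA hB
  exact mul_ne_zero hA hB (Finsupp.single_eq_zero.1 h'')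

variable {E₁ : Type*} [NormedAddCommGroup E₁] [NormedSpace ℂ E₁]
  {H₁ : Type*} [TopologicalSpace H₁] {I₁ : ModelWithCorners ℂ E₁ H₁}
  {X₁ : Type*} [TopologicalSpace X₁] [ChartedSpace H₁ X₁]
  {E₂ : Type*} [NormedAddCommGroup E₂] [NormedSpace ℂ E₂]
  {H₂ : Type*} [TopologicalSpace H₂] {I₂ : ModelWithCorners ℂ E₂ H₂}
  {X₂ : Type*} [TopologicalSpace X₂] [ChartedSpace H₂ X₂]
  {Γ₁ : Set (X₁ × X₁) →₀ ℕ} {Γ₂ : Set (X₂ × X₂) →₀ ℕ}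

lemma finite_prodSet_fiber_fst {A : Set (X₁ × X₁)} {B : Set (X₂ × X₂)} {z : X₁ × X₂}
    (hA : (A ∩ Prod.fst ⁻¹' {z.1}).Finite) (hB : (B ∩ Prod.fst ⁻¹' {z.2}).Finite) :
    (prodSet A B ∩ Prod.fst ⁻¹' {z}).Finite := by
  refine ((hA.prod hB).preimage
    (Homeomorph.prodProdProdComm X₁ X₂ X₁ X₂).injective.injOn).subset ?_
  rintro p ⟨⟨h₁, h₂⟩, rfl⟩
  exact ⟨⟨h₁, rfl⟩, ⟨h₂, rfl⟩⟩

lemma finite_prodSet_fiber_snd {A : Set (X₁ × X₁)} {B : Set (X₂ × X₂)} {z : X₁ × X₂}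
    (hA : (A ∩ Prod.snd ⁻¹' {z.1}).Finite) (hB : (B ∩ Prod.snd ⁻¹' {z.2}).Finite) :
    (prodSet A B ∩ Prod.snd ⁻¹' {z}).Finite := by
  refine ((hA.prod hB).preimage
    (Homeomorph.prodProdProdComm X₁ X₂ X₁ X₂).injective.injOn).subset ?_
  rintro p ⟨⟨h₁, h₂⟩, rfl⟩
  exact ⟨⟨h₁, rfl⟩, ⟨h₂, rfl⟩⟩

theorem IsHolomorphicCorrespondence.prodCorr [FiniteDimensional ℂ E₁] [FiniteDimensional ℂ E₂]
    (h₁ : IsHolomorphicCorrespondence I₁ Γ₁) (h₂ : IsHolomorphicCorrespondence I₂ Γ₂) :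
    IsHolomorphicCorrespondence (I₁.prod I₂) (prodCorr Γ₁ Γ₂) where
  ne_zero := prodCorr_ne_zero h₁.ne_zero h₂.ne_zero
  irreducible C hC := by
    obtain ⟨A, hA, B, hB, rfl⟩ := exists_of_mem_support_prodCorr hC
    rw [Module.finrank_prod]
    exact (h₁.irreducible A hA).prodSet (h₂.irreducible B hB)
  surjective_fst C hC := by
    obtain ⟨A, hA, B, hB, rfl⟩ := exists_of_mem_support_prodCorr hC
    refine Set.eq_univ_of_forall fun z => ?_
    obtain ⟨⟨a, a'⟩, ha, rfl⟩ : z.1 ∈ Prod.fst '' A := h₁.surjective_fst A hA ▸ Set.mem_univ _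
    obtain ⟨⟨b, b'⟩, hb, hz⟩ : z.2 ∈ Prod.fst '' B := h₂.surjective_fst B hB ▸ Set.mem_univ _
    exact ⟨(z, (a', b')), ⟨ha, by rw [← hz]; exact hb⟩, rfl⟩
  surjective_snd C hC := by
    obtain ⟨A, hA, B, hB, rfl⟩ := exists_of_mem_support_prodCorr hC
    refine Set.eq_univ_of_forall fun z => ?_
    obtain ⟨⟨a', a⟩, ha, ha'⟩ : z.1 ∈ Prod.snd '' A := h₁.surjective_snd A hA ▸ Set.mem_univ _
    obtain ⟨⟨b', b⟩, hb, hz⟩ : z.2 ∈ Prod.snd '' B := h₂.surjective_snd B hB ▸ Set.mem_univ _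
    exact ⟨((a', b'), z), ⟨by rw [← ha']; exact ha, by rw [← hz]; exact hb⟩, rfl⟩
  finite_images C hC z := by
    obtain ⟨A, hA, B, hB, rfl⟩ := exists_of_mem_support_prodCorr hC
    refine ⟨finite_prodSet_fiber_fst (h₁.finite_images A hA _).1 (h₂.finite_images B hB _).1,
      fun p _ => ?_⟩
    have hA' := h₁.localMultiplicity_fst_ne_top hA (p.1.1, p.2.1)
    have hB' := h₂.localMultiplicity_fst_ne_top hB (p.1.2, p.2.2)
    rw [localMultiplicity_fst_prodSet hA' hB']
    exact WithTop.mul_ne_top hA' hB'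
  finite_preimages C hC z := by
    obtain ⟨A, hA, B, hB, rfl⟩ := exists_of_mem_support_prodCorr hC
    refine ⟨finite_prodSet_fiber_snd (h₁.finite_preimages A hA _).1
      (h₂.finite_preimages B hB _).1, fun p _ => ?_⟩
    have hA' := h₁.localMultiplicity_snd_ne_top hA (p.1.1, p.2.1)
    have hB' := h₂.localMultiplicity_snd_ne_top hB (p.1.2, p.2.2)
    rw [localMultiplicity_snd_prodSet hA' hB']
    exact WithTop.mul_ne_top hA' hB'

lemma preimageMultiplicity_prodCorr (h₁ : IsHolomorphicCorrespondence I₁ Γ₁)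
    (h₂ : IsHolomorphicCorrespondence I₂ Γ₂) (w z : X₁ × X₂) :
    preimageMultiplicity (prodCorr Γ₁ Γ₂) w z =
      preimageMultiplicity Γ₁ w.1 z.1 * preimageMultiplicity Γ₂ w.2 z.2 := by
  classical
  -- The summand is additive in the coefficient, so the sum expands over pairs (A, B) even if some
  -- products coincide.
  rw [preimageMultiplicity, HolCorr.prodCorr, Finsupp.sum_sum_index (by simp)
    (fun _ _ _ => add_mul _ _ _), preimageMultiplicity, preimageMultiplicity,
    Finsupp.sum, Finsupp.sum, Finset.sum_mul]
  refine Finset.sum_congr rfl fun A hA => ?_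
  rw [Finsupp.sum_sum_index (by simp) (fun _ _ _ => add_mul _ _ _), Finsupp.sum, Finsupp.sum,
    Finset.mul_sum]
  refine Finset.sum_congr rfl fun B hB => ?_
  rw [Finsupp.sum_single_index (by simp), localMultiplicity_snd_prodSet
    (h₁.localMultiplicity_snd_ne_top hA _) (h₂.localMultiplicity_snd_ne_top hB _), ENat.toNat_mul]
  ring

lemma preimages_prodCorr [FiniteDimensional ℂ E₁] [FiniteDimensional ℂ E₂]
    (h₁ : IsHolomorphicCorrespondence I₁ Γ₁) (h₂ : IsHolomorphicCorrespondence I₂ Γ₂)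
    (z : X₁ × X₂) :
    preimages (prodCorr Γ₁ Γ₂) z = preimages Γ₁ z.1 ×ˢ preimages Γ₂ z.2 := by
  classical
  ext w
  rw [count_preimages ((h₁.prodCorr h₂).finite_support_preimageMultiplicity z),
    count_product, count_preimages (h₁.finite_support_preimageMultiplicity _),
    count_preimages (h₂.finite_support_preimageMultiplicity _),
    preimageMultiplicity_prodCorr h₁ h₂]

lemma HasTopologicalDegree.prodCorr [FiniteDimensional ℂ E₁] [FiniteDimensional ℂ E₂]
    (h₁ : IsHolomorphicCorrespondence I₁ Γ₁) (h₂ : IsHolomorphicCorrespondence I₂ Γ₂) {d₁ d₂ : ℕ}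
    (hd₁ : HasTopologicalDegree I₁ Γ₁ d₁) (hd₂ : HasTopologicalDegree I₂ Γ₂ d₂) :
    HasTopologicalDegree (I₁.prod I₂) (prodCorr Γ₁ Γ₂) (d₁ * d₂) := by
  obtain ⟨Z₁, hZ₁, hne₁, hcard₁⟩ := hd₁
  obtain ⟨Z₂, hZ₂, hne₂, hcard₂⟩ := hd₂
  obtain ⟨z₁, hz₁⟩ := (Set.ne_univ_iff_exists_notMem _).1 hne₁
  obtain ⟨z₂, hz₂⟩ := (Set.ne_univ_iff_exists_notMem _).1 hne₂
  -- Outside this proper subvariety both coordinates are generic, and cardinalities of products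
  -- multiply.
  refine ⟨Prod.fst ⁻¹' Z₁ ∪ Prod.snd ⁻¹' Z₂, (hZ₁.preimage mdifferentiable_fst).union
    (hZ₂.preimage mdifferentiable_snd), ?_, fun z hz => ?_⟩
  · exact (Set.ne_univ_iff_exists_notMem _).2 ⟨(z₁, z₂), by simp [hz₁, hz₂]⟩
  · simp only [Set.mem_union, Set.mem_preimage, not_or] at hz
    rw [preimages_prodCorr h₁ h₂, Multiset.card_product, hcard₁ _ hz.1, hcard₂ _ hz.2]

end Product

end HolCorr

/-- Second countability makes each compact Hausdorff factor metrizable, so closed sets can be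
approximated by continuous functions, and makes open sets of X₁ × X₂ measurable for the product
σ-algebra. -/
lemma HolCorr.secondCountableTopology_of_compactSpace (E : Type*) [NormedAddCommGroup E]
    [NormedSpace ℂ E] [FiniteDimensional ℂ E] (X : Type*) [TopologicalSpace X] [CompactSpace X]
    [ChartedSpace E X] : SecondCountableTopology X := by
  have := FiniteDimensional.proper ℂ E
  exact ChartedSpace.secondCountable_of_sigmaCompact E X


theorem mainTheorem9
    {E₁ : Type*} [NormedAddCommGroup E₁] [NormedSpace ℂ E₁] [FiniteDimensional ℂ E₁]
    {E₂ : Type*} [NormedAddCommGroup E₂] [NormedSpace ℂ E₂] [FiniteDimensional ℂ E₂]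
    {X₁ : Type*} [TopologicalSpace X₁] [T2Space X₁] [CompactSpace X₁] [ConnectedSpace X₁]
    [ChartedSpace E₁ X₁] [IsManifold 𝓘(ℂ, E₁) ω X₁] [MeasurableSpace X₁] [BorelSpace X₁]
    {X₂ : Type*} [TopologicalSpace X₂] [T2Space X₂] [CompactSpace X₂] [ConnectedSpace X₂]
    [ChartedSpace E₂ X₂] [IsManifold 𝓘(ℂ, E₂) ω X₂] [MeasurableSpace X₂] [BorelSpace X₂]
    (Γ₁ : Set (X₁ × X₁) →₀ ℕ) (Γ₂ : Set (X₂ × X₂) →₀ ℕ)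
    (hΓ₁ : HolCorr.IsHolomorphicCorrespondence 𝓘(ℂ, E₁) Γ₁)
    (hΓ₂ : HolCorr.IsHolomorphicCorrespondence 𝓘(ℂ, E₂) Γ₂) :
    HolCorr.IsHolomorphicCorrespondence (𝓘(ℂ, E₁).prod 𝓘(ℂ, E₂)) (HolCorr.prodCorr Γ₁ Γ₂) ∧
    ∀ d₁ d₂ : ℕ,
      HolCorr.HasTopologicalDegree 𝓘(ℂ, E₁) Γ₁ d₁ →
      HolCorr.HasTopologicalDegree 𝓘(ℂ, E₂) Γ₂ d₂ →
      HolCorr.HasTopologicalDegree (𝓘(ℂ, E₁).prod 𝓘(ℂ, E₂))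
        (HolCorr.prodCorr Γ₁ Γ₂) (d₁ * d₂) ∧
      ∀ (μ₁ : Measure X₁) (μ₂ : Measure X₂)
        [IsProbabilityMeasure μ₁] [IsProbabilityMeasure μ₂],
        HolCorr.IsStarInvariant Γ₁ d₁ μ₁ →
        HolCorr.IsStarInvariant Γ₂ d₂ μ₂ →
        (∀ n : ℕ, HolCorr.IsPullback (HolCorr.iterPreimages (HolCorr.prodCorr Γ₁ Γ₂) n)
          (μ₁.prod μ₂) (((d₁ : ℝ≥0∞) ^ n * (d₂ : ℝ≥0∞) ^ n) • μ₁.prod μ₂)) ∧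
        HolCorr.IsStarInvariant (HolCorr.prodCorr Γ₁ Γ₂) (d₁ * d₂) (μ₁.prod μ₂) := by

  refine ⟨hΓ₁.prodCorr hΓ₂, fun d₁ d₂ hd₁ hd₂ =>
    ⟨hd₁.prodCorr hΓ₁ hΓ₂ hd₂, fun μ₁ μ₂ _ _ hμ₁ hμ₂ => ?_⟩⟩
  have := HolCorr.secondCountableTopology_of_compactSpace E₁ X₁
  have := HolCorr.secondCountableTopology_of_compactSpace E₂ X₂
  have : IsFiniteMeasure ((d₁ : ℝ≥0∞) • μ₁) := Measure.smul_finite _ (ENNReal.natCast_ne_top d₁)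
  have : IsFiniteMeasure ((d₂ : ℝ≥0∞) • μ₂) := Measure.smul_finite _ (ENNReal.natCast_ne_top d₂)
  have hpb : ∀ f : X₁ × X₂ → ℝ≥0∞, Measurable f →
      HolCorr.PullsBack (HolCorr.preimages (HolCorr.prodCorr Γ₁ Γ₂)) (μ₁.prod μ₂)
        (((d₁ : ℝ≥0∞) * d₂) • μ₁.prod μ₂) f := by
    intro f hf
    convert HolCorr.pullsBack_product (fun f hf => HolCorr.IsPullback.pullsBack hμ₁ hf)
      (fun f hf => HolCorr.IsPullback.pullsBack hμ₂ hf) hf using 1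
    · exact funext (HolCorr.preimages_prodCorr hΓ₁ hΓ₂)
    · rw [Measure.prod_smul_left, Measure.prod_smul_right, smul_smul]
  refine ⟨fun n => ?_, ?_⟩
  · have : IsFiniteMeasure (((d₁ : ℝ≥0∞) ^ n * (d₂ : ℝ≥0∞) ^ n) • μ₁.prod μ₂) :=
      Measure.smul_finite _ (by finiteness)
    -- This puts the factor in the form cⁿ with c = d₁d₂, as iteration of the product correspondence
    -- produces it.
    rw [← mul_pow] at this ⊢
    exact HolCorr.isPullback_of_pullsBack fun f hf =>
      HolCorr.pullsBack_iterPreimages hpb n hf.aemeasurable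
  · have : IsFiniteMeasure (((d₁ * d₂ : ℕ) : ℝ≥0∞) • μ₁.prod μ₂) :=
      Measure.smul_finite _ (ENNReal.natCast_ne_top _)
    refine HolCorr.isPullback_of_pullsBack fun f hf => ?_
    rw [Nat.cast_mul]
    exact hpb f hf
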